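/- **Theorem (Brent–Krattenthaler–Warnaar's identity).** *Definitions.* For an integer $N \ge 0$ and a partition $\lambda$, an *$N$-symplectic tableau* of shape $\lambda$ is a filling of the Young diagram of $\lambda$ with the first $N$ letters of the ordered alphabet $1 < \bar 1 < 2 < \bar 2 < 3 < \bar 3 < \cdots$ such that entries weakly increase along rows, strictly increase down columns, and every entry in the $i$th row is at least the letter $i$. For $\lambda$ of length $\le n$, the symplectic character $\mathrm{Sp}_{2n}(\lambda; x_1,\dots,x_n)$ is $$\mathrm{Sp}_{2n}(\lambda; x_1,\dots,x_n) = \sum_T \prod_{k=1}^n x_k^{\#\{k \text{ in } T\} - \#\{\bar k \text{ in } T\}},$$ the sum being over all $2n$-symplectic tableaux $T$ of shape $\lambda$. For $\lambda$ of length $\le n+1$, the odd symplectic character $\mathrm{Sp}_{2n+1}(\lambda; x_1,\dots,x_n; z)$ is $$\mathrm{Sp}_{2n+1}(\lambda; x_1,\dots,x_n; z) = \sum_T z^{\#\{n+1 \text{ in } T\}} \prod_{k=1}^n x_k^{\#\{k \text{ in } T\} - \#\{\bar k \text{ in } T\}},$$ the sum being over all $(2n+1)$-symplectic tableaux $T$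 of shape $\lambda$ (letters $1 < \bar 1 < \cdots < n < \bar n < n+1$). We write $(r^l)$ for the partition with $l$ parts equal to $r$, and $\mu \cup \nu$ for the partition whose parts are the parts of $\mu$ and of $\nu$, arranged in decreasing order. *Statement.* Let $0 \le m \le n$ and $r \ge 0$ be integers. Then $$\sum_{\lambda} z^{-r}\, \mathrm{Sp}_{2m+1}(\lambda; x_1,\dots,x_m; z)\, \mathrm{Sp}_{2n+1}\big((r^{n-m}) \cup \lambda; y_1,\dots,y_n; z\big) = \mathrm{Sp}_{2(m+n+1)}\big((r^{m+n+1}); x_1,\dots,x_m,y_1,\dots,y_n,z\big),$$ where $\lambda$ runs over all partitions of length $\le m+1$ with $\lambda_1 \le r$. This is an identity of Laurent polynomials with integer coefficients in the variables $x_1,\dots,x_m,y_1,\dots,y_n,z$; equivalently, it holds whenever these variables are replaced by units of any commutative ring. -/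

import Mathlib

/-- The rectangular partition `(r^l)`: `l` rows, each of length `r`. -/
def rectangle (l r : ℕ) : YoungDiagram where
  cells := Finset.range l ×ˢ Finset.range r
  isLowerSet := by
    rintro ⟨i, j⟩ ⟨i', j'⟩ ⟨h₁, h₂⟩ h
    simp only [Finset.coe_product, Finset.coe_range, Set.mem_prod, Set.mem_Iio] at h ⊢
    exact ⟨lt_of_le_of_lt h₁ h.1, lt_of_le_of_lt h₂ h.2⟩

/-- The union `μ ∪ ν` of two partitions: the partition whose parts are those of `μ` together with
those of `ν` (with multiplicities), arranged in weakly decreasing order. -/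
def partitionUnion (μ ν : YoungDiagram) : YoungDiagram :=
  YoungDiagram.ofRowLens (((μ.rowLens : Multiset ℕ) + (ν.rowLens : Multiset ℕ)).sort (· ≥ ·))
    (Multiset.pairwise_sort _ _).sortedGE

/-- Partitions of length at most `l` (at most `l` nonempty rows) with largest part at most `r`. -/
def PartitionInBox (l r : ℕ) : Type :=
  {μ : YoungDiagram // μ.colLen 0 ≤ l ∧ μ.rowLen 0 ≤ r}

instance instFinitePartitionInBox (l r : ℕ) : Finite (PartitionInBox l r) := by
  have key : ∀ μ : PartitionInBox l r, μ.1.cells ∈ (Finset.range l ×ˢ Finset.range r).powerset := by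
    rintro ⟨μ, h₁, h₂⟩
    rw [Finset.mem_powerset]
    rintro ⟨i, j⟩ hc
    have hc' : (i, j) ∈ μ := hc
    have hi : i < μ.colLen 0 :=
      YoungDiagram.mem_iff_lt_colLen.1 (μ.up_left_mem le_rfl (Nat.zero_le j) hc')
    have hj : j < μ.rowLen 0 :=
      YoungDiagram.mem_iff_lt_rowLen.1 (μ.up_left_mem (Nat.zero_le i) le_rfl hc')
    simp only [Finset.mem_product, Finset.mem_range]
    omega
  refine Finite.of_injective
    (fun μ => (⟨μ.1.cells, key μ⟩ : (Finset.range l ×ˢ Finset.range r).powerset)) ?_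
  intro μ ν h
  exact Subtype.ext (YoungDiagram.ext (congrArg Subtype.val h))

noncomputable instance instFintypePartitionInBox (l r : ℕ) : Fintype (PartitionInBox l r) :=
  Fintype.ofFinite _

/-- Symplectic tableaux of shape `μ` for `Sp_N` (`N` even or odd).  The `N` letters
`1 < 1̄ < 2 < 2̄ < ⋯` are coded by `0 < 1 < 2 < 3 < ⋯ < N - 1`: the letter `k` is coded
by `2 (k - 1)` and the letter `k̄` by `2 (k - 1) + 1`.  A symplectic tableau is a semistandard
tableau in these letters all of whose entries in row `i` are at least the letter `i`;
since rows are numbered from `0` here, this says that entries in row `i` are at least `2 * i`. -/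
def SymplecticTableau (N : ℕ) (μ : YoungDiagram) : Type :=
  {T : SemistandardYoungTableau μ // ∀ i j, (i, j) ∈ μ → 2 * i ≤ T i j ∧ T i j < N}

instance instFiniteSymplecticTableau (N : ℕ) (μ : YoungDiagram) :
    Finite (SymplecticTableau N μ) := by
  refine Finite.of_injective
    (fun (T : SymplecticTableau N μ) (c : μ.cells) =>
      (⟨T.1 c.1.1 c.1.2, (T.2 _ _ c.2).2⟩ : Fin N)) ?_
  intro T S h
  refine Subtype.ext (SemistandardYoungTableau.ext fun i j => ?_)
  by_cases hc : (i, j) ∈ μ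
  · exact congrArg Fin.val (congrFun h ⟨(i, j), hc⟩)
  · rw [T.1.zeros hc, S.1.zeros hc]

noncomputable instance instFintypeSymplecticTableau (N : ℕ) (μ : YoungDiagram) :
    Fintype (SymplecticTableau N μ) :=
  Fintype.ofFinite _

/-- The weights of the letters `1 < 1̄ < ⋯ < n < n̄ < n + 1`, coded as above: the letter `k ≤ n` has
weight `x_k`, the letter `k̄` has weight `x_k⁻¹`, and the letter `n + 1` has weight `z`. -/
def letterWeight {R : Type*} [CommRing R] {n : ℕ} (x : Fin n → Rˣ) (z : Rˣ) (a : ℕ) : Rˣ :=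
  if h : a / 2 < n then (if a % 2 = 0 then x ⟨a / 2, h⟩ else (x ⟨a / 2, h⟩)⁻¹) else z

/-- The weight of a tableau: the product of the weights of its entries. -/
def tableauWeight {R : Type*} [CommRing R] (w : ℕ → Rˣ) {N : ℕ} {μ : YoungDiagram}
    (T : SymplecticTableau N μ) : R :=
  ((∏ c ∈ μ.cells, w (T.1 c.1 c.2) : Rˣ) : R)

/-- The odd symplectic character `Sp_{2n+1}(μ; x₁, …, xₙ; z)`, for `μ` of length at most `n + 1`. -/
noncomputable def oddSymplecticChar {R : Type*} [CommRing R] {n : ℕ} (μ : YoungDiagram)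
    (x : Fin n → Rˣ) (z : Rˣ) : R :=
  ∑ T : SymplecticTableau (2 * n + 1) μ, tableauWeight (letterWeight x z) T

/-- The symplectic character `Sp_{2n}(μ; x₁, …, xₙ)`, for `μ` of length at most `n`.  Only the
letters `1, 1̄, …, n, n̄` occur here, so the value `1` given to the letter `n + 1` plays no role. -/
noncomputable def symplecticChar {R : Type*} [CommRing R] {n : ℕ} (μ : YoungDiagram)
    (x : Fin n → Rˣ) : R :=
  ∑ T : SymplecticTableau (2 * n) μ, tableauWeight (letterWeight x 1) T

/-! Recording the shapes occupied by the first `N` letters turns a symplectic tableau into a chain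
of interlacing partitions, so characters become sums over chains, `branchSum`
(`sum_tableauWeight_eq_branchSum`).

For the rectangle `(r^k)` in `2k` letters, remove the `j ≤ k` largest letters. Interlacing forces
the remaining shape to be `(r^{k-j})` followed by some `c` in a box, and the successive tails `c`
themselves interlace in the opposite direction. Hence the removed part is again a chain, with
reversed letters and inverted weights, times an `r`-th power of weights (`branchSum_rectangle`). Now
order the variables as `y₁, …, yₙ, z, x_m, …, x₁` and take `j = 2m + 1`. The cut falls between the
letters of weights `z` and `z⁻¹`, and both sides become odd symplectic characters.

That ordering is allowed because even symplectic characters are symmetric in their variables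
(`branchSum_two_mul_symm`). This follows from a Jacobi–Trudi type determinant: its rows are built up
one variable at a time, and a unitriangular change of rows makes it visibly symmetric. -/

open Finset PowerSeries

section Lemmas

variable {R : Type*} [CommRing R]

/-! ### Interlacing sequences and sums over chains. -/

/-- Extension by zero of a tuple of length `K` to a sequence. -/
def zeroExtend (K : ℕ) (f : Fin K → ℕ) (i : ℕ) : ℕ := if h : i < K then f ⟨i, h⟩ else 0

theorem zeroExtend_coe {K : ℕ} (f : Fin K → ℕ) (i : Fin K) : zeroExtend K f i = f i := by
  simp [zeroExtend]

theorem zeroExtend_injective (K : ℕ) : Function.Injective (zeroExtend K) := fun f g h =>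
  funext fun i => by rw [← zeroExtend_coe f, h, zeroExtend_coe]

/-- The sequences `ν` with `lo i ≤ ν i ≤ hi i` for `i < K` and `ν i = 0` for `K ≤ i`. -/
def tupleBox (K : ℕ) (lo hi : ℕ → ℕ) : Finset (ℕ → ℕ) :=
  (Fintype.piFinset fun i : Fin K => Finset.Icc (lo i) (hi i)).map
    ⟨zeroExtend K, zeroExtend_injective K⟩

theorem mem_tupleBox {K : ℕ} {lo hi ν : ℕ → ℕ} :
    ν ∈ tupleBox K lo hi ↔ (∀ i < K, lo i ≤ ν i ∧ ν i ≤ hi i) ∧ ∀ i, K ≤ i → ν i = 0 := by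
  simp only [tupleBox, Finset.mem_map, Fintype.mem_piFinset, Finset.mem_Icc,
    Function.Embedding.coeFn_mk]
  constructor
  · rintro ⟨f, hf, rfl⟩
    refine ⟨fun i hi => ?_, fun i hi => ?_⟩
    · simpa [zeroExtend, hi] using hf ⟨i, hi⟩
    · simp [zeroExtend, not_lt.2 hi]
  · rintro ⟨h₁, h₂⟩
    refine ⟨fun i => ν i, fun i => h₁ i i.2, funext fun i => ?_⟩
    by_cases hi : i < K
    · simp [zeroExtend, hi]
    · simp [zeroExtend, hi, h₂ i (not_lt.1 hi)]

theorem sum_tupleBox {M : Type*} [AddCommMonoid M] (K : ℕ) (lo hi : ℕ → ℕ) (F : (ℕ → ℕ) → M) :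
    ∑ ν ∈ tupleBox K lo hi, F ν
      = ∑ f ∈ Fintype.piFinset fun i : Fin K => Finset.Icc (lo i) (hi i), F (zeroExtend K f) := by
  simp [tupleBox]

/-- Consecutive terms are separated by `p`: `ν (i + 1) ≤ p (i + 1) ≤ ν i`. Monotonicity of `p`
itself plays no role. -/
theorem antitone_of_mem_tupleBox {K : ℕ} {p ν : ℕ → ℕ}
    (h : ν ∈ tupleBox K (fun i => p (i + 1)) p) : Antitone ν := by
  obtain ⟨h₁, h₂⟩ := mem_tupleBox.1 h
  refine antitone_nat_of_succ_le fun i => ?_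
  by_cases hi : i + 1 < K
  · exact (h₁ _ hi).2.trans (h₁ i (by omega)).1
  · simp [h₂ (i + 1) (not_lt.1 hi)]

/-- The sum over all chains of interlacing sequences ending at `p`, the `N`-th one of which has
at most `(N + 1) / 2` nonzero terms, where the `a`-th step has weight `w a`. -/
def branchSum (w : ℕ → Rˣ) : ℕ → (ℕ → ℕ) → R
  | 0, _ => 1
  | N + 1, p => ∑ ν ∈ tupleBox ((N + 1) / 2) (fun i => p (i + 1)) p,
      ((w N ^ (∑ i ∈ range ((N + 2) / 2), p i) * (w N)⁻¹ ^ (∑ i ∈ range ((N + 1) / 2), ν i) : Rˣ) :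
        R) * branchSum w N ν

theorem branchSum_congr {w w' : ℕ → Rˣ} {N : ℕ} (h : ∀ a < N, w a = w' a) (p : ℕ → ℕ) :
    branchSum w N p = branchSum w' N p := by
  induction N generalizing p with
  | zero => rfl
  | succ N ih =>
    simp only [branchSum, h N N.lt_succ_self]
    exact sum_congr rfl fun ν _ => by rw [ih fun a ha => h a (ha.trans N.lt_succ_self)]

/-! ### Coefficient determinants under one branching step. -/

/-- With a zero column in position `K`, subtracting from each column its successor is a
unitriangular operation. It undoes the differences that arise from sums over interlacing sequences.
-/
theorem det_sub_succ_col (K : ℕ) (G : ℕ → ℕ → R) (hG : ∀ i, G i K = 0) :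
    (Matrix.of fun i j : Fin K => G i j - G i (j + 1)).det
      = (Matrix.of fun i j : Fin K => G i j).det := by
  cases K with
  | zero => simp
  | succ k =>
    -- Reversal makes the successor column a predecessor, and the last column, which is unchanged,
    -- the first.
    rw [← Matrix.det_submatrix_equiv_self Fin.revPerm (Matrix.of fun i j : Fin (k + 1) => G i j),
      ← Matrix.det_submatrix_equiv_self Fin.revPerm]
    symm
    refine Matrix.det_eq_of_forall_col_eq_smul_add_pred (fun _ => 1) (fun i => ?_) fun i j => ?_
    · simp [hG]
    · have h : k - (j.1 + 1) + 1 = k - j.1 := by omega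
      simp [Fin.val_rev, h]

/-- The determinant with the entries `[t ^ (p j + (k - 1 - j))] f i`. -/
noncomputable def coeffDet (k : ℕ) (f : ℕ → R⟦X⟧) (p : ℕ → ℕ) : R :=
  (Matrix.of fun i j : Fin k => coeff (p j + (k - 1 - j)) (f i)).det

/-- The geometric series `1 / (1 - x t)`. -/
noncomputable def geom (x : R) : R⟦X⟧ := PowerSeries.mk fun n => x ^ n

theorem geom_mul_one_sub (x : R) : geom x * (1 - C x * X) = 1 := by
  ext n
  cases n with
  | zero => simp [geom, mul_sub]
  | succ n =>
    rw [mul_sub, mul_one, ← mul_assoc, map_sub, coeff_succ_mul_X, mul_comm, coeff_C_mul]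
    simp [geom, pow_succ', coeff_one]

theorem coeff_geom_mul (x : Rˣ) (f : R⟦X⟧) (n : ℕ) :
    coeff n (geom (x : R) * f)
      = (x : R) ^ n * ∑ t ∈ range (n + 1), ((x⁻¹ : Rˣ) : R) ^ t * coeff t f := by
  rw [mul_comm, coeff_mul, Finset.Nat.sum_antidiagonal_eq_sum_range_succ_mk, mul_sum]
  refine sum_congr rfl fun t ht => ?_
  have ht' : t ≤ n := by simpa [Nat.lt_succ_iff] using ht
  have h : (x : R) ^ n = (x : R) ^ (n - t) * (x : R) ^ t := by rw [← pow_add, Nat.sub_add_cancel ht']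
  have h1 : (x : R) ^ t * ((x⁻¹ : Rˣ) : R) ^ t = 1 := by rw [← mul_pow]; simp
  simp only [geom, coeff_mk, h]
  linear_combination -(coeff t f) * (x : R) ^ (n - t) * h1

theorem sum_Icc_shift (H : ℕ → R) {a b : ℕ} (hab : a ≤ b) (c : ℕ) :
    ∑ t ∈ Icc a b, H (t + c) = ∑ t ∈ range (b + c + 1), H t - ∑ t ∈ range (a + c), H t := by
  rw [← Finset.sum_Ico_eq_sub H (by omega : a + c ≤ b + c + 1),
    show b + c + 1 = (b + 1) + c by ring, ← Finset.sum_Ico_add' H a (b + 1) c]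
  rfl

/-- A sum of column-indexed determinants over a box is the determinant of the column sums. -/
theorem sum_tupleBox_det (K : ℕ) (lo hi : ℕ → ℕ) (H : ℕ → ℕ → ℕ → R) :
    ∑ ν ∈ tupleBox K lo hi, (Matrix.of fun i j : Fin K => H i j (ν j)).det
      = (Matrix.of fun i j : Fin K => ∑ t ∈ Icc (lo j) (hi j), H i j t).det := by
  rw [sum_tupleBox, ← Matrix.det_transpose]
  have := (Matrix.detRowAlternating (n := Fin K) (R := R)).toMultilinearMap.map_sum_finset
    (fun (j : Fin K) (t : ℕ) (i : Fin K) => H i j t) (fun j => Icc (lo j) (hi j))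
  have e : (Matrix.of fun i j : Fin K => ∑ t ∈ Icc (lo j) (hi j), H i j t).transpose
      = fun j : Fin K => ∑ t ∈ Icc (lo j) (hi j), fun i : Fin K => H i j t := by
    ext i j; simp
  rw [e]
  refine Eq.trans ?_ this.symm
  refine sum_congr rfl fun f _ => ?_
  rw [← Matrix.det_transpose]
  simp only [zeroExtend_coe]
  rfl

/-- The partial sums `∑_{t < n} x⁻¹ ^ (t + 1) [t ^ t] f`. -/
noncomputable def partialSum (x : Rˣ) (f : R⟦X⟧) (n : ℕ) : R :=
  ∑ t ∈ range n, ((x⁻¹ : Rˣ) : R) ^ (t + 1) * coeff t f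

theorem coeff_geom_mul_eq_partialSum (x : Rˣ) (f : R⟦X⟧) (n : ℕ) :
    coeff n (geom (x : R) * f) = (x : R) ^ (n + 1) * partialSum x f (n + 1) := by
  have h : (x : R) * ((x⁻¹ : Rˣ) : R) = 1 := by simp
  rw [coeff_geom_mul, partialSum, mul_sum, mul_sum]
  refine sum_congr rfl fun t _ => ?_
  rw [pow_succ (x : R) n, pow_succ]
  linear_combination -((x : R) ^ n * ((x⁻¹ : Rˣ) : R) ^ t * coeff t f) * h

theorem coeff_X_mul_geom_mul (x : Rˣ) (f : R⟦X⟧) (n : ℕ) :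
    coeff n (X * geom (x : R) * f) = (x : R) ^ n * partialSum x f n := by
  cases n with
  | zero => simp [partialSum, mul_assoc]
  | succ n => rw [mul_assoc, coeff_succ_X_mul, coeff_geom_mul_eq_partialSum]

/-- The sum is taken column by column. Spreading `x⁻¹ ^ (ν j + (K - j))` over column `j` makes every
column use the same summand `x⁻¹ ^ (t + 1) * coeff t f`, so its sum over an interval is a difference
of partial sums whose lower end is the upper end for column `j + 1`. The prefactor repays the extra
`K - j`. -/
theorem sum_coeffDet_eq_det_partialSum (x : Rˣ) (K : ℕ) (f : ℕ → R⟦X⟧) {p : ℕ → ℕ}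
    (hp : Antitone p) :
    ∑ ν ∈ tupleBox K (fun i => p (i + 1)) p,
        ((x⁻¹ ^ (∑ i ∈ range K, ν i) : Rˣ) : R) * coeffDet K f ν
      = (x : R) ^ (∑ i ∈ range K, (K - i)) * (Matrix.of fun i j : Fin K =>
          partialSum x (f i) (p j + (K - j)) - partialSum x (f i) (p (j + 1) + (K - (j + 1)))).det := by
  have key : ∀ ν : ℕ → ℕ, ((x⁻¹ ^ (∑ i ∈ range K, ν i) : Rˣ) : R) * coeffDet K f ν
      = (x : R) ^ (∑ i ∈ range K, (K - i)) * (Matrix.of fun i j : Fin K =>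
          ((x⁻¹ : Rˣ) : R) ^ (ν j + (K - 1 - j) + 1) * coeff (ν j + (K - 1 - j)) (f i)).det := by
    intro ν
    have h := Matrix.det_mul_row (fun j : Fin K => ((x⁻¹ : Rˣ) : R) ^ (ν j + (K - 1 - j) + 1))
      (Matrix.of fun i j : Fin K => coeff (ν j + (K - 1 - j)) (f i))
    simp only [Matrix.of_apply] at h
    rw [h, coeffDet, ← mul_assoc]
    congr 1
    rw [Fin.prod_univ_eq_prod_range (fun j => ((x⁻¹ : Rˣ) : R) ^ (ν j + (K - 1 - j) + 1)),
      prod_pow_eq_pow_sum]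
    have e : ∑ i ∈ range K, (ν i + (K - 1 - i) + 1) = ∑ i ∈ range K, ν i + ∑ i ∈ range K, (K - i) := by
      rw [← sum_add_distrib]
      refine sum_congr rfl fun i hi => ?_
      have := mem_range.1 hi
      omega
    rw [e, pow_add, mul_left_comm, ← mul_pow]
    simp
  simp only [key]
  rw [← mul_sum, sum_tupleBox_det K _ _ (fun i j t =>
    ((x⁻¹ : Rˣ) : R) ^ (t + (K - 1 - j) + 1) * coeff (t + (K - 1 - j)) (f i))]
  congr 3
  ext i j
  have h1 : K - 1 - j.1 + 1 = K - j := by omega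
  have h2 : K - 1 - j.1 = K - (j + 1) := by omega
  rw [sum_Icc_shift (fun t => ((x⁻¹ : Rˣ) : R) ^ (t + 1) * coeff t (f i)) (hp (Nat.le_succ j)),
    add_assoc, h1, h2]
  rfl

/-- Since `p K = 0`, the partial sum in position `K` is empty and the column differences can be
undone. The column factors `x ^ (p j + (K - j))` then turn partial sums into coefficients of `geom x
* f i`. -/
theorem sum_coeffDet_same_length (x : Rˣ) (K : ℕ) (f : ℕ → R⟦X⟧) {p : ℕ → ℕ}
    (hp : Antitone p) (hK : p K = 0) :
    ∑ ν ∈ tupleBox K (fun i => p (i + 1)) p,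
        ((x ^ (∑ i ∈ range K, p i) * x⁻¹ ^ (∑ i ∈ range K, ν i) : Rˣ) : R) * coeffDet K f ν
      = coeffDet K (fun i => geom (x : R) * f i) p := by
  simp only [Units.val_mul, mul_assoc]
  rw [← mul_sum, sum_coeffDet_eq_det_partialSum x K f hp,
    det_sub_succ_col K (fun i j => partialSum x (f i) (p j + (K - j)))
      (fun i => by simp [hK, partialSum]), coeffDet, ← mul_assoc, Units.val_pow_eq_pow_val,
    ← pow_add, ← sum_add_distrib, ← prod_pow_eq_pow_sum,
    ← Fin.prod_univ_eq_prod_range (fun j => (x : R) ^ (p j + (K - j)))]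
  refine (Matrix.det_mul_row _ _).symm.trans ?_
  congr 2
  ext i j
  have h1 : K - j.1 = K - 1 - j + 1 := by omega
  rw [coeff_geom_mul_eq_partialSum, Matrix.of_apply, h1, add_assoc]

theorem sum_coeffDet_succ_length (x : Rˣ) (k : ℕ) {f f' : ℕ → R⟦X⟧}
    (hf : ∀ i < k, f' i = X * geom (x : R) * f i) (hk : f' k = geom (x : R)) {p : ℕ → ℕ}
    (hp : Antitone p) :
    ∑ ν ∈ tupleBox k (fun i => p (i + 1)) p,
        ((x ^ (∑ i ∈ range (k + 1), p i) * x⁻¹ ^ (∑ i ∈ range k, ν i) : Rˣ) : R) * coeffDet k f ν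
      = coeffDet (k + 1) f' p := by
  -- Row `k` is what `geom x` becomes once `x ^ (p j + (k - j))` is taken out of column `j`; column
  -- `k + 1` is set to zero.
  set G : ℕ → ℕ → R := fun i j =>
    if j ≤ k then if i < k then partialSum x (f i) (p j + (k - j)) else 1 else 0 with hG
  have h1 : coeffDet (k + 1) f' p
      = (x : R) ^ (∑ i ∈ range (k + 1), (p i + (k - i)))
        * (Matrix.of fun i j : Fin (k + 1) => G i j).det := by
    rw [← prod_pow_eq_pow_sum, ← Fin.prod_univ_eq_prod_range (fun j => (x : R) ^ (p j + (k - j)))]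
    refine Eq.trans ?_ (Matrix.det_mul_row _ _)
    rw [coeffDet]
    congr 2
    ext i j
    have hj : j.1 ≤ k := Nat.lt_succ_iff.1 j.2
    simp only [Matrix.of_apply, hG, hj, if_true, Nat.add_sub_cancel]
    split_ifs with hi
    · rw [hf _ hi, coeff_X_mul_geom_mul]
    · rw [show (i : ℕ) = k by omega, hk, geom, coeff_mk, mul_one]
  have h2 : (Matrix.of fun i j : Fin (k + 1) => G i j).det
      = (Matrix.of fun i j : Fin k => partialSum x (f i) (p j + (k - j))
          - partialSum x (f i) (p (j + 1) + (k - (j + 1)))).det := by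
    -- After the column differences, row `k` is `(0, …, 0, 1)`; expanding along it leaves the `k ×
    -- k` determinant.
    rw [← det_sub_succ_col (k + 1) G fun i => by simp [hG], Matrix.det_succ_row _ (Fin.last k),
      Fin.sum_univ_castSucc, sum_eq_zero, zero_add]
    · rw [show ((-1 : R) ^ ((Fin.last k : ℕ) + (Fin.last k : ℕ))) = 1 from
        Even.neg_one_pow ⟨_, rfl⟩]
      simp only [Matrix.of_apply, hG, Fin.val_last, le_refl, if_true, lt_irrefl, if_false,
        Nat.not_succ_le_self, sub_zero, one_mul]
      congr 1
      ext i j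
      have hj : j.1 ≤ k := j.2.le
      simp [hj]
    · intro j _
      have hj : j.1 ≤ k := j.2.le
      simp [hG, hj]
  simp only [Units.val_mul, mul_assoc]
  rw [← mul_sum, sum_coeffDet_eq_det_partialSum x k f hp, h1, h2, sum_add_distrib,
    sum_range_succ (fun i => k - i) k, pow_add, Units.val_pow_eq_pow_val, Nat.sub_self, add_zero,
    mul_assoc]

/-! ### Determinant formula and symmetry of the even characters. -/

/-- The weights `u 0, (u 0)⁻¹, u 1, (u 1)⁻¹, …`. -/
def pairWeight (u : ℕ → Rˣ) (a : ℕ) : Rˣ := if a % 2 = 0 then u (a / 2) else (u (a / 2))⁻¹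

theorem pairWeight_even (u : ℕ → Rˣ) (k : ℕ) : pairWeight u (2 * k) = u k := by
  simp [pairWeight]

theorem pairWeight_odd (u : ℕ → Rˣ) (k : ℕ) : pairWeight u (2 * k + 1) = (u k)⁻¹ := by
  simp [pairWeight, Nat.add_mod, show (2 * k + 1) / 2 = k by omega]

/-- The series `1 / ((1 - x t) (1 - x⁻¹ t))`. -/
noncomputable def pairSeries (x : Rˣ) : R⟦X⟧ := geom (x : R) * geom ((x⁻¹ : Rˣ) : R)

/-- The polynomial `(1 - x t) (1 - x⁻¹ t)`. -/
noncomputable def pairDenom (x : Rˣ) : R⟦X⟧ := 1 + X ^ 2 - C ((x : R) + ((x⁻¹ : Rˣ) : R)) * X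

theorem pairSeries_mul_pairDenom (x : Rˣ) : pairSeries x * pairDenom x = 1 := by
  have h1 := geom_mul_one_sub (x : R)
  have h2 := geom_mul_one_sub ((x⁻¹ : Rˣ) : R)
  have h3 : (C (x : R) : R⟦X⟧) * C ((x⁻¹ : Rˣ) : R) = 1 := by rw [← map_mul]; simp
  have h4 : pairDenom x = (1 - C (x : R) * X) * (1 - C ((x⁻¹ : Rˣ) : R) * X) := by
    rw [pairDenom, map_add]
    linear_combination (-X ^ 2) * h3
  rw [h4, pairSeries, mul_mul_mul_comm, h1, h2, one_mul]

/-- The rows of the determinant for the even symplectic character. -/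
noncomputable def symplecticRow (u : ℕ → Rˣ) (k i : ℕ) : R⟦X⟧ :=
  (∏ a ∈ range k, pairSeries (u a)) * (X ^ (k - 1 - i) * ∏ a ∈ range i, pairDenom (u a))

theorem symplecticRow_succ_of_lt (u : ℕ → Rˣ) {k i : ℕ} (hi : i < k) :
    symplecticRow u (k + 1) i = X * pairSeries (u k) * symplecticRow u k i := by
  rw [symplecticRow, symplecticRow, prod_range_succ, show k + 1 - 1 - i = (k - 1 - i) + 1 by omega,
    pow_succ]
  ring

theorem symplecticRow_succ_self (u : ℕ → Rˣ) (k : ℕ) :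
    symplecticRow u (k + 1) k = pairSeries (u k) := by
  have h : (∏ a ∈ range k, pairSeries (u a)) * ∏ a ∈ range k, pairDenom (u a) = 1 := by
    rw [← prod_mul_distrib]
    exact prod_eq_one fun a _ => pairSeries_mul_pairDenom _
  rw [symplecticRow, prod_range_succ, Nat.add_sub_cancel, Nat.sub_self, pow_zero, one_mul,
    mul_right_comm, h, one_mul]

theorem coeffDet_congr {k : ℕ} {f g : ℕ → R⟦X⟧} (h : ∀ i < k, f i = g i) (p : ℕ → ℕ) :
    coeffDet k f p = coeffDet k g p := by
  rw [coeffDet, coeffDet]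
  congr 2
  ext i j
  rw [h i i.2]

/-- A new variable costs two branching steps: its unbarred letter lengthens the determinant by one
row, and its barred letter keeps the length and supplies the second geometric factor of
`pairSeries`. -/
theorem branchSum_two_mul (u : ℕ → Rˣ) (k : ℕ) {p : ℕ → ℕ} (hp : Antitone p) (hk : p k = 0) :
    branchSum (pairWeight u) (2 * k) p = coeffDet k (symplecticRow u k) p := by
  induction k generalizing p with
  | zero => simp [branchSum, coeffDet]
  | succ k ih =>
    rw [mul_add, mul_one]
    have e1 : (2 * k + 1 + 2) / 2 = k + 1 := by omega
    have e2 : (2 * k + 1 + 1) / 2 = k + 1 := by omega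
    have e4 : (2 * k + 1) / 2 = k := by omega
    simp only [branchSum, e1, e2, e4, pairWeight_even, pairWeight_odd]
    let f' : ℕ → R⟦X⟧ := fun i =>
      if i < k then X * geom (u k : R) * symplecticRow u k i else geom (u k : R)
    have inner : ∀ ν ∈ tupleBox (k + 1) (fun i => p (i + 1)) p,
        ∑ ρ ∈ tupleBox k (fun i => ν (i + 1)) ν,
          ((u k ^ (∑ i ∈ range (k + 1), ν i) * (u k)⁻¹ ^ (∑ i ∈ range k, ρ i) : Rˣ) : R)
            * branchSum (pairWeight u) (2 * k) ρ = coeffDet (k + 1) f' ν := by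
      intro ν hν
      rw [← sum_coeffDet_succ_length (u k) k (f := symplecticRow u k) (f' := f')
        (fun i hi => by simp [f', hi]) (by simp [f']) (antitone_of_mem_tupleBox hν)]
      exact sum_congr rfl fun ρ hρ => by
        rw [ih (antitone_of_mem_tupleBox hρ) ((mem_tupleBox.1 hρ).2 k le_rfl)]
    rw [sum_congr rfl fun ν hν => congrArg _ (inner ν hν), sum_coeffDet_same_length _ _ _ hp hk]
    refine coeffDet_congr (fun i hi => ?_) p
    rcases Nat.lt_succ_iff_lt_or_eq.1 hi with h | rfl
    · simp only [f', if_pos h]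
      rw [symplecticRow_succ_of_lt u h, pairSeries]
      ring
    · simp only [f', lt_irrefl, if_false]
      rw [symplecticRow_succ_self, pairSeries, mul_comm]

/-- The product is homogeneous of degree `i` in `Y` and `T` and monic in `Y`, so the coefficients
for varying `i` form a lower unitriangular matrix. -/
theorem exists_prod_sub_eq_sum {A : Type*} [CommRing A] (s : ℕ → R) (φ : R →+* A) (Y T : A)
    (i : ℕ) : ∃ c : ℕ → R, c i = 1 ∧ (∀ j, i < j → c j = 0) ∧
      ∏ a ∈ range i, (Y - φ (s a) * T) = ∑ j ∈ range (i + 1), φ (c j) * (T ^ (i - j) * Y ^ j) := by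
  induction i with
  | zero => exact ⟨fun j => if j = 0 then 1 else 0, by simp, fun j hj => by simp; omega, by simp⟩
  | succ i ih =>
    obtain ⟨c, hc1, hc0, hc⟩ := ih
    refine ⟨fun j => (if j = 0 then 0 else c (j - 1)) - s i * c j, ?_, fun j hj => ?_, ?_⟩
    · simp [hc1, hc0 (i + 1) (Nat.lt_succ_self i)]
    · have : j ≠ 0 := by omega
      simp [this, hc0 j (by omega), hc0 (j - 1) (by omega)]
    · rw [prod_range_succ, hc, mul_sub]
      simp only [map_sub, map_mul, sub_mul, sum_sub_distrib]
      congr 1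
      · rw [sum_range_succ' _ (i + 1)]
        simp only [Nat.succ_ne_zero, if_false, if_true, map_zero, zero_mul, add_zero,
          Nat.add_sub_cancel, Nat.add_sub_add_right, sum_mul]
        exact sum_congr rfl fun j _ => by rw [pow_succ]; ring
      · rw [sum_range_succ _ (i + 1), hc0 (i + 1) (Nat.lt_succ_self i), map_zero, mul_zero,
          zero_mul, add_zero, sum_mul]
        refine sum_congr rfl fun j hj => ?_
        rw [Nat.succ_sub (Nat.lt_succ_iff.1 (mem_range.1 hj)), pow_succ]
        ring

/-- Each `pairDenom` is `(1 + X ^ 2) - s X`, so the row polynomials are homogeneous of degree `k -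
1` in `X` and `1 + X ^ 2`. A row operation of determinant 1 replaces them by monomials, leaving the
variables only in the common symmetric product. -/
theorem coeffDet_symplecticRow (u : ℕ → Rˣ) (k : ℕ) (p : ℕ → ℕ) :
    coeffDet k (symplecticRow u k) p = coeffDet k (fun i =>
      (∏ a ∈ range k, pairSeries (u a)) * (X ^ (k - 1 - i) * (1 + X ^ 2) ^ i)) p := by
  choose c hc1 hc0 hc using
    exists_prod_sub_eq_sum (fun a => (u a : R) + (((u a)⁻¹ : Rˣ) : R)) (C : R →+* R⟦X⟧) (1 + X ^ 2) X
  have hdet : (Matrix.of fun i j : Fin k => c i j).det = 1 := by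
    rw [Matrix.det_of_isLowerTriangular]
    · simp [hc1]
    · intro i j hij
      exact hc0 _ _ hij
  rw [coeffDet, coeffDet]
  refine Eq.trans ?_ ((congrArg (· * _) hdet).trans (one_mul _))
  rw [← Matrix.det_mul]
  congr 1
  ext i j
  rw [Matrix.mul_apply, Matrix.of_apply]
  simp only [Matrix.of_apply, ← coeff_C_mul]
  rw [← map_sum, Fin.sum_univ_eq_sum_range (fun l => C (c i l) *
    ((∏ a ∈ range k, pairSeries (u a)) * (X ^ (k - 1 - l) * (1 + X ^ 2) ^ l))) k]
  congr 1
  rw [symplecticRow]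
  simp only [pairDenom]
  rw [hc i, mul_sum, mul_sum]
  have hi := i.2
  refine (sum_subset (range_subset_range.2 hi) fun l hl hl' => ?_).symm.trans ?_ |>.symm
  · rw [hc0 _ _ (by simpa using hl'), map_zero, zero_mul]
  · refine sum_congr rfl fun l hl => ?_
    have hl := Nat.lt_succ_iff.1 (mem_range.1 hl)
    rw [show k - 1 - l = (k - 1 - i) + (i - l) by omega, pow_add]
    ring

/-- The even symplectic characters depend symmetrically on their variables. -/
theorem branchSum_two_mul_symm {u v : ℕ → Rˣ} {k : ℕ}
    (huv : ∏ a ∈ range k, pairSeries (u a) = ∏ a ∈ range k, pairSeries (v a)) {p : ℕ → ℕ}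
    (hp : Antitone p) (hk : p k = 0) :
    branchSum (pairWeight u) (2 * k) p = branchSum (pairWeight v) (2 * k) p := by
  rw [branchSum_two_mul u k hp hk, branchSum_two_mul v k hp hk, coeffDet_symplecticRow,
    coeffDet_symplecticRow, huv]

/-! ### Cutting a rectangle into two chains. -/

/-- The sequence consisting of `a` terms equal to `r`, followed by `c`. -/
def constPrefix (a r : ℕ) (c : ℕ → ℕ) (i : ℕ) : ℕ := if i < a then r else c (i - a)

theorem constPrefix_add (a r : ℕ) (c : ℕ → ℕ) (i : ℕ) : constPrefix a r c (a + i) = c i := by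
  simp [constPrefix]

theorem constPrefix_of_lt {a i : ℕ} (h : i < a) (r : ℕ) (c : ℕ → ℕ) : constPrefix a r c i = r := by
  simp [constPrefix, h]

theorem sum_constPrefix (a r L : ℕ) (c : ℕ → ℕ) :
    ∑ i ∈ range (a + L), constPrefix a r c i = a * r + ∑ i ∈ range L, c i := by
  rw [sum_range_add]
  simp only [constPrefix_add]
  rw [sum_congr rfl fun i hi => constPrefix_of_lt (mem_range.1 hi) r c]
  simp

/-- The first `a` terms are squeezed between `r` and `r`. On the tails, `c t ≤ c' t ≤ c (t - 1)`,
with `r` in place of `c (-1)`, is the same as `c' (t + 1) ≤ c t ≤ c' t` together with `c' 0 ≤ r`: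
the direction of interlacing flips. -/
theorem constPrefix_mem_tupleBox_iff {a r L L' : ℕ} (h₁ : L ≤ L') (h₂ : L' ≤ L + 1) (h₃ : 0 < L')
    {c c' : ℕ → ℕ} (hc : c ∈ tupleBox L (fun _ => 0) fun _ => r) :
    constPrefix a r c' ∈ tupleBox (a + L') (fun i => constPrefix (a + 1) r c (i + 1))
        (constPrefix (a + 1) r c)
      ↔ c' ∈ tupleBox L' (fun _ => 0) (fun _ => r) ∧ c ∈ tupleBox L (fun i => c' (i + 1)) c' := by
  simp only [mem_tupleBox] at hc ⊢
  obtain ⟨hc1, hc2⟩ := hc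
  have e1 : ∀ i, constPrefix (a + 1) r c (a + i + 1) = c i := fun i => by
    rw [add_right_comm, constPrefix_add]
  have e0 : ∀ i, i ≤ a → constPrefix (a + 1) r c i = r := fun i hi =>
    constPrefix_of_lt (Nat.lt_succ_of_le hi) r c
  constructor
  · rintro ⟨h, h'⟩
    have g : ∀ t < L', c t ≤ c' t ∧ c' t ≤ constPrefix (a + 1) r c (a + t) := fun t ht => by
      have := h (a + t) (by omega)
      rwa [constPrefix_add, e1] at this
    have z : ∀ t, L' ≤ t → c' t = 0 := fun t ht => by
      have := h' (a + t) (by omega)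
      rwa [constPrefix_add] at this
    have s : ∀ t, t + 1 < L' → c' (t + 1) ≤ c t := fun t ht => by
      have := (g (t + 1) ht).2
      rwa [← add_assoc, e1] at this
    refine ⟨⟨fun t ht => ⟨Nat.zero_le _, ?_⟩, z⟩, fun t ht => ⟨?_, (g t (by omega)).1⟩, hc2⟩
    · cases t with
      | zero => exact (g 0 ht).2.trans (e0 a le_rfl).le
      | succ t => exact (s t ht).trans (hc1 t (by omega)).2
    · by_cases ht' : t + 1 < L'
      · exact s t ht'
      · simp [z (t + 1) (not_lt.1 ht')]
  · rintro ⟨⟨h, h'⟩, g, -⟩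
    refine ⟨fun i hi => ?_, fun i hi => ?_⟩
    · rcases lt_or_ge i a with hia | hia
      · rw [e0 _ hia, e0 _ hia.le, constPrefix_of_lt hia]
        exact ⟨le_rfl, le_rfl⟩
      · obtain ⟨t, rfl⟩ := Nat.exists_eq_add_of_le hia
        rw [e1, constPrefix_add]
        refine ⟨?_, ?_⟩
        · by_cases ht : t < L
          · exact (g t ht).2
          · simp [hc2 t (not_lt.1 ht)]
        · cases t with
          | zero => exact (h 0 h₃).2.trans (e0 a le_rfl).ge
          | succ t =>
            rw [← add_assoc, e1]
            exact (g t (by omega)).1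
    · obtain ⟨t, rfl⟩ := Nat.exists_eq_add_of_le ((Nat.le_add_right a L').trans hi)
      rw [constPrefix_add, h' t (by omega)]

theorem eq_constPrefix_of_mem_tupleBox {a r L' : ℕ} {c ν : ℕ → ℕ}
    (h : ν ∈ tupleBox (a + L') (fun i => constPrefix (a + 1) r c (i + 1))
      (constPrefix (a + 1) r c)) : constPrefix a r (fun i => ν (a + i)) = ν := by
  funext i
  rcases lt_or_ge i a with hia | hia
  · have := (mem_tupleBox.1 h).1 i (by omega)
    rw [constPrefix_of_lt (by omega), constPrefix_of_lt (by omega)] at this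
    rw [constPrefix_of_lt hia]
    exact le_antisymm this.1 this.2
  · obtain ⟨t, rfl⟩ := Nat.exists_eq_add_of_le hia
    rw [constPrefix_add]

/-- The `a` common rows cancel in the weight and the lost row contributes `w M ^ r`. The rest is the
weight of a step from `c` up to `c'` with letter weight `(w M)⁻¹`, whence the double inverse. -/
theorem branchSum_constPrefix (w : ℕ → Rˣ) {a r L L' M : ℕ} (h₁ : L ≤ L') (h₂ : L' ≤ L + 1)
    (h₃ : 0 < L') (hM : (M + 1) / 2 = a + L') (hM' : (M + 2) / 2 = a + 1 + L) {c : ℕ → ℕ}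
    (hc : c ∈ tupleBox L (fun _ => 0) fun _ => r) [DecidableEq (ℕ → ℕ)] :
    branchSum w (M + 1) (constPrefix (a + 1) r c)
      = ∑ c' ∈ (tupleBox L' (fun _ => 0) fun _ => r).filter
            fun c' => c ∈ tupleBox L (fun i => c' (i + 1)) c',
          ((w M ^ r * ((w M)⁻¹ ^ (∑ i ∈ range L', c' i) * (w M)⁻¹⁻¹ ^ (∑ i ∈ range L, c i)) : Rˣ) : R)
            * branchSum w M (constPrefix a r c') := by
  rw [branchSum, hM, hM']
  refine sum_bij' (fun ν _ i => ν (a + i)) (fun c' _ => constPrefix a r c') (fun ν hν => ?_)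
    (fun c' hc' => ?_) (fun ν hν => eq_constPrefix_of_mem_tupleBox hν)
    (fun c' _ => funext fun i => constPrefix_add a r c' i) (fun ν hν => ?_)
  · rw [mem_filter, ← constPrefix_mem_tupleBox_iff (a := a) h₁ h₂ h₃ hc,
      eq_constPrefix_of_mem_tupleBox hν]
    exact hν
  · exact (constPrefix_mem_tupleBox_iff h₁ h₂ h₃ hc).2 (mem_filter.1 hc')
  · rw [eq_constPrefix_of_mem_tupleBox hν]
    congr 2
    have e : ∑ i ∈ range (a + L'), ν i = a * r + ∑ i ∈ range L', ν (a + i) := by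
      rw [← sum_constPrefix a r L' fun i => ν (a + i), eq_constPrefix_of_mem_tupleBox hν]
    rw [e, sum_constPrefix, inv_inv, add_mul, one_mul, pow_add, pow_add, pow_add, inv_pow (w M) (a * r)]
    generalize w M ^ (a * r) = A
    rw [show ∀ B C D : Rˣ, A * B * C * (A⁻¹ * D) = B * (D * C) from fun B C D => by
      rw [mul_assoc A B C, mul_mul_mul_comm, mul_inv_cancel, one_mul, mul_assoc, mul_comm C D]]

theorem branchSum_rectangle (w : ℕ → Rˣ) (k r j : ℕ) (hj : j ≤ k) :
    branchSum w (2 * k) (constPrefix k r fun _ => 0)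
      = ((∏ i ∈ range j, w (2 * k - 1 - i) ^ r : Rˣ) : R)
        * ∑ c ∈ tupleBox ((j + 1) / 2) (fun _ => 0) fun _ => r,
            branchSum (fun i => (w (2 * k - 1 - i))⁻¹) j c
              * branchSum w (2 * k - j) (constPrefix (k - j) r c) := by
  classical
  induction j with
  | zero =>
    have e : tupleBox 0 (fun _ => 0) (fun _ => r) = {fun _ => 0} := by
      ext ν
      simp [mem_tupleBox, funext_iff]
    simp [e, branchSum]
  | succ j ih =>
    obtain ⟨a, ha⟩ := Nat.exists_eq_add_of_le hj
    rw [ih (by omega), prod_range_succ, Units.val_mul, mul_assoc]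
    congr 1
    set M := 2 * k - 1 - j with hMdef
    have e1 : 2 * k - j = M + 1 := by omega
    have e2 : 2 * k - (j + 1) = M := by omega
    have e3 : k - j = a + 1 := by omega
    have e4 : k - (j + 1) = a := by omega
    have h₁ : (j + 1) / 2 ≤ (j + 1 + 1) / 2 := by omega
    have h₂ : (j + 1 + 1) / 2 ≤ (j + 1) / 2 + 1 := by omega
    have h₃ : 0 < (j + 1 + 1) / 2 := by omega
    have hM : (M + 1) / 2 = a + (j + 1 + 1) / 2 := by omega
    have hM' : (M + 2) / 2 = a + 1 + (j + 1) / 2 := by omega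
    rw [e1, e2, e3, e4, sum_congr rfl fun c hc => by
      rw [branchSum_constPrefix w h₁ h₂ h₃ hM hM' hc, mul_sum], mul_sum]
    -- With `c'` outermost, the inner sum over `c` is one branching step of the reversed chain; the
    -- box condition on `c` follows from interlacing with `c'`.
    rw [sum_comm' (t' := tupleBox ((j + 1 + 1) / 2) (fun _ => 0) fun _ => r)
      (s' := fun c' => tupleBox ((j + 1) / 2) (fun i => c' (i + 1)) c')]
    · refine sum_congr rfl fun c' _ => ?_
      rw [branchSum, sum_mul, mul_sum]
      refine sum_congr rfl fun c _ => ?_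
      simp only [← hMdef, Units.val_mul]
      ring
    · intro c c'
      rw [mem_filter]
      refine ⟨fun h => ⟨h.2.2, h.2.1⟩, fun h => ⟨?_, h.2, h.1⟩⟩
      have hc' := mem_tupleBox.1 h.2
      have hc := mem_tupleBox.1 h.1
      exact mem_tupleBox.2 ⟨fun i hi =>
        ⟨Nat.zero_le _, (hc.1 i hi).2.trans (hc'.1 i (hi.trans_le h₁)).2⟩, hc.2⟩

/-! ### From tableaux to chains of row lengths. -/

theorem rowLen_eq_zero_of_colLen_le {μ : YoungDiagram} {i : ℕ} (h : μ.colLen 0 ≤ i) :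
    μ.rowLen i = 0 := by
  by_contra hne
  exact absurd (YoungDiagram.mem_iff_lt_colLen.1
    (YoungDiagram.mem_iff_lt_rowLen.2 (Nat.pos_of_ne_zero hne))) (not_lt.2 h)

theorem colLen_zero_le_iff {μ : YoungDiagram} {K : ℕ} :
    μ.colLen 0 ≤ K ↔ ∀ i, K ≤ i → μ.rowLen i = 0 := by
  refine ⟨fun h i hi => rowLen_eq_zero_of_colLen_le (h.trans hi), fun h => not_lt.1 fun hlt => ?_⟩
  have := YoungDiagram.mem_iff_lt_rowLen.1 (YoungDiagram.mem_iff_lt_colLen.2 hlt)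
  rw [h K le_rfl] at this
  exact absurd this (Nat.not_lt_zero 0)

theorem youngDiagram_eq_of_rowLen_eq {μ ν : YoungDiagram} (h : μ.rowLen = ν.rowLen) : μ = ν := by
  ext ⟨i, j⟩
  rw [YoungDiagram.mem_cells, YoungDiagram.mem_cells, YoungDiagram.mem_iff_lt_rowLen,
    YoungDiagram.mem_iff_lt_rowLen, h]

theorem card_cells_eq_sum_rowLen {μ : YoungDiagram} {K : ℕ} (h : μ.colLen 0 ≤ K) :
    μ.cells.card = ∑ i ∈ range K, μ.rowLen i := by
  rw [Finset.card_eq_sum_card_fiberwise (f := Prod.fst) (t := range K)]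
  · exact sum_congr rfl fun i _ => by rw [YoungDiagram.rowLen_eq_card]; rfl
  · rintro ⟨i, j⟩ hc
    have hc' : (i, j) ∈ μ := hc
    simpa using (YoungDiagram.mem_iff_lt_colLen.1 (μ.up_left_mem le_rfl (Nat.zero_le j) hc')).trans_le h

/-- The Young diagram whose first `K` rows have the lengths `p 0, …, p (K - 1)`. -/
def diagramOfRows (K : ℕ) (p : ℕ → ℕ) (hp : Antitone p) : YoungDiagram where
  cells := (range K ×ˢ range (p 0)).filter fun c => c.2 < p c.1
  isLowerSet := by
    rintro ⟨i, j⟩ ⟨i', j'⟩ ⟨h₁, h₂⟩ h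
    simp only [coe_filter, mem_product, mem_range, Set.mem_ofPred_eq] at h h₁ h₂ ⊢
    have := hp h₁
    omega

theorem mem_diagramOfRows {K : ℕ} {p : ℕ → ℕ} {hp : Antitone p} {i j : ℕ} :
    (i, j) ∈ diagramOfRows K p hp ↔ i < K ∧ j < p i := by
  rw [← YoungDiagram.mem_cells]
  have := hp (Nat.zero_le i)
  simp only [diagramOfRows, mem_filter, mem_product, mem_range]
  omega

theorem rowLen_diagramOfRows {K : ℕ} {p : ℕ → ℕ} (hp : Antitone p) (h : ∀ i, K ≤ i → p i = 0) :
    (diagramOfRows K p hp).rowLen = p := by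
  funext i
  refine eq_of_forall_lt_iff fun j => ?_
  rw [← YoungDiagram.mem_iff_lt_rowLen, mem_diagramOfRows, and_iff_right_iff_imp]
  intro hj
  by_contra hi
  rw [h i (not_lt.1 hi)] at hj
  exact absurd hj (Nat.not_lt_zero j)

theorem SymplecticTableau.ext' {N : ℕ} {μ : YoungDiagram} {S T : SymplecticTableau N μ}
    (h : ∀ i j, (i, j) ∈ μ → S.1 i j = T.1 i j) : S = T := by
  refine Subtype.ext (SemistandardYoungTableau.ext fun i j => ?_)
  by_cases hc : (i, j) ∈ μ
  · exact h i j hc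
  · rw [S.1.zeros hc, T.1.zeros hc]

/-- The cells of a tableau that contain one of the first `N` letters. -/
def smallDiagram {μ : YoungDiagram} (N : ℕ) (T : SemistandardYoungTableau μ) : YoungDiagram where
  cells := μ.cells.filter fun c => T c.1 c.2 < N
  isLowerSet := by
    rintro ⟨i, j⟩ ⟨i', j'⟩ ⟨h₁, h₂⟩ h
    simp only [coe_filter, YoungDiagram.mem_cells, Set.mem_ofPred_eq] at h h₁ h₂ ⊢
    exact ⟨μ.up_left_mem h₁ h₂ h.1, (T.row_weak_of_le h₂ (μ.up_left_mem h₁ le_rfl h.1)).trans_lt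
      ((T.col_weak h₁ h.1).trans_lt h.2)⟩

theorem mem_smallDiagram {μ : YoungDiagram} {N : ℕ} {T : SemistandardYoungTableau μ} {i j : ℕ} :
    (i, j) ∈ smallDiagram N T ↔ (i, j) ∈ μ ∧ T i j < N := by
  rw [← YoungDiagram.mem_cells]
  simp [smallDiagram]

/-- Strict columns allow at most one letter `N` in a column, which gives the lower bound. The
condition `2 * i ≤ T i j < N` leaves at most `(N + 1) / 2` rows. -/
theorem rowLen_smallDiagram_mem_tupleBox {μ : YoungDiagram} {N : ℕ}
    (T : SymplecticTableau (N + 1) μ) :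
    (smallDiagram N T.1).rowLen ∈ tupleBox ((N + 1) / 2) (fun i => μ.rowLen (i + 1)) μ.rowLen := by
  refine mem_tupleBox.2 ⟨fun i _ => ⟨?_, ?_⟩, fun i hi => ?_⟩
  · refine le_of_forall_lt fun j hj => ?_
    have hc := YoungDiagram.mem_iff_lt_rowLen.2 hj
    rw [← YoungDiagram.mem_iff_lt_rowLen, mem_smallDiagram]
    exact ⟨μ.up_left_mem (Nat.le_succ i) le_rfl hc, (T.1.col_strict (Nat.lt_succ_self i) hc).trans_le
      (Nat.lt_succ_iff.1 (T.2 _ _ hc).2)⟩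
  · refine le_of_forall_lt fun j hj => ?_
    exact YoungDiagram.mem_iff_lt_rowLen.1 (mem_smallDiagram.1 (YoungDiagram.mem_iff_lt_rowLen.2 hj)).1
  · by_contra hne
    have hc := mem_smallDiagram.1 (YoungDiagram.mem_iff_lt_rowLen.2 (Nat.pos_of_ne_zero hne))
    have := (T.2 _ _ hc.1).1
    omega

/-- Fills the cells of `μ` outside of `ν` with the letter `N`. -/
def extendTableau {N : ℕ} {μ ν : YoungDiagram} (hμ : μ.colLen 0 ≤ (N + 2) / 2)
    (hle : ∀ i, ν.rowLen i ≤ μ.rowLen i) (hint : ∀ i, μ.rowLen (i + 1) ≤ ν.rowLen i)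
    (S : SymplecticTableau N ν) : SymplecticTableau (N + 1) μ :=
  ⟨{ entry := fun i j => if j < ν.rowLen i then S.1 i j else if j < μ.rowLen i then N else 0
     row_weak' := by
      intro i j₁ j₂ hj hc
      rw [YoungDiagram.mem_iff_lt_rowLen] at hc
      by_cases h₂ : j₂ < ν.rowLen i
      · rw [if_pos h₂, if_pos (hj.trans h₂)]
        exact S.1.row_weak hj (YoungDiagram.mem_iff_lt_rowLen.2 h₂)
      · rw [if_neg h₂, if_pos hc]
        split_ifs with h₁
        · exact (S.2 _ _ (YoungDiagram.mem_iff_lt_rowLen.2 h₁)).2.le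
        · exact le_rfl
        · exact Nat.zero_le N
     col_strict' := by
      intro i₁ i₂ j hi hc
      rw [YoungDiagram.mem_iff_lt_rowLen] at hc
      have h₁ : j < ν.rowLen i₁ := hc.trans_le ((μ.rowLen_anti _ _ hi).trans (hint i₁))
      rw [if_pos h₁]
      by_cases h₂ : j < ν.rowLen i₂
      · rw [if_pos h₂]
        exact S.1.col_strict hi (YoungDiagram.mem_iff_lt_rowLen.2 h₂)
      · rw [if_neg h₂, if_pos hc]
        exact (S.2 _ _ (YoungDiagram.mem_iff_lt_rowLen.2 h₁)).2
     zeros' := by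
      intro i j hc
      rw [YoungDiagram.mem_iff_lt_rowLen] at hc
      rw [if_neg fun h => hc (h.trans_le (hle i)), if_neg hc] },
  by
    intro i j hc
    have hi : i < μ.colLen 0 :=
      YoungDiagram.mem_iff_lt_colLen.1 (μ.up_left_mem le_rfl (Nat.zero_le j) hc)
    rw [YoungDiagram.mem_iff_lt_rowLen] at hc
    change 2 * i ≤ (if _ then _ else _) ∧ (if _ then _ else _) < N + 1
    split_ifs with h
    · have := S.2 _ _ (YoungDiagram.mem_iff_lt_rowLen.2 h)
      omega
    · omega⟩

theorem extendTableau_apply {N : ℕ} {μ ν : YoungDiagram} (hμ : μ.colLen 0 ≤ (N + 2) / 2)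
    (hle : ∀ i, ν.rowLen i ≤ μ.rowLen i) (hint : ∀ i, μ.rowLen (i + 1) ≤ ν.rowLen i)
    (S : SymplecticTableau N ν) (i j : ℕ) : (extendTableau hμ hle hint S).1 i j
      = if j < ν.rowLen i then S.1 i j else if j < μ.rowLen i then N else 0 := rfl

/-- The restriction of a tableau to the cells that contain one of the first `N` letters. -/
def restrictTableau {N : ℕ} {μ : YoungDiagram} (T : SymplecticTableau (N + 1) μ) :
    SymplecticTableau N (smallDiagram N T.1) :=
  ⟨{ entry := fun i j => if (i, j) ∈ smallDiagram N T.1 then T.1 i j else 0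
     row_weak' := by
      intro i j₁ j₂ hj hc
      rw [if_pos hc, if_pos ((smallDiagram N T.1).up_left_mem le_rfl hj.le hc)]
      exact T.1.row_weak hj (mem_smallDiagram.1 hc).1
     col_strict' := by
      intro i₁ i₂ j hi hc
      rw [if_pos hc, if_pos ((smallDiagram N T.1).up_left_mem hi.le le_rfl hc)]
      exact T.1.col_strict hi (mem_smallDiagram.1 hc).1
     zeros' := fun hc => if_neg hc },
  by
    intro i j hc
    change 2 * i ≤ (if _ then _ else _) ∧ (if _ then _ else _) < N
    rw [if_pos hc]
    exact ⟨(T.2 _ _ (mem_smallDiagram.1 hc).1).1, (mem_smallDiagram.1 hc).2⟩⟩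

theorem restrictTableau_apply {N : ℕ} {μ : YoungDiagram} (T : SymplecticTableau (N + 1) μ) {i j : ℕ}
    (hc : (i, j) ∈ smallDiagram N T.1) : (restrictTableau T).1 i j = T.1 i j := if_pos hc

theorem exists_extendTableau_eq {N : ℕ} {μ ν : YoungDiagram} (hμ : μ.colLen 0 ≤ (N + 2) / 2)
    (hle : ∀ i, ν.rowLen i ≤ μ.rowLen i) (hint : ∀ i, μ.rowLen (i + 1) ≤ ν.rowLen i)
    (T : SymplecticTableau (N + 1) μ) (h : smallDiagram N T.1 = ν) :
    ∃ S, extendTableau hμ hle hint S = T := by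
  subst h
  refine ⟨restrictTableau T, SymplecticTableau.ext' fun i j hc => ?_⟩
  rw [extendTableau_apply]
  split_ifs with h₁ h₂
  · exact restrictTableau_apply T (YoungDiagram.mem_iff_lt_rowLen.2 h₁)
  · rw [← YoungDiagram.mem_iff_lt_rowLen, mem_smallDiagram] at h₁
    have := (T.2 _ _ hc).2
    have : ¬ T.1 i j < N := fun h => h₁ ⟨hc, h⟩
    omega
  · exact absurd (YoungDiagram.mem_iff_lt_rowLen.1 hc) h₂

theorem smallDiagram_extendTableau {N : ℕ} {μ ν : YoungDiagram} (hμ : μ.colLen 0 ≤ (N + 2) / 2)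
    (hle : ∀ i, ν.rowLen i ≤ μ.rowLen i) (hint : ∀ i, μ.rowLen (i + 1) ≤ ν.rowLen i)
    (S : SymplecticTableau N ν) : smallDiagram N (extendTableau hμ hle hint S).1 = ν := by
  refine youngDiagram_eq_of_rowLen_eq (funext fun i => eq_of_forall_lt_iff fun j => ?_)
  rw [← YoungDiagram.mem_iff_lt_rowLen, mem_smallDiagram, extendTableau_apply,
    YoungDiagram.mem_iff_lt_rowLen]
  constructor
  · rintro ⟨h, h'⟩
    by_contra hlt
    rw [if_neg hlt, if_pos h] at h'
    exact lt_irrefl _ h'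
  · intro h
    rw [if_pos h]
    exact ⟨h.trans_le (hle i), (S.2 _ _ (YoungDiagram.mem_iff_lt_rowLen.2 h)).2⟩

theorem tableauWeight_extendTableau (w : ℕ → Rˣ) {N : ℕ} {μ ν : YoungDiagram}
    (hμ : μ.colLen 0 ≤ (N + 2) / 2) (hν : ν.colLen 0 ≤ (N + 1) / 2)
    (hle : ∀ i, ν.rowLen i ≤ μ.rowLen i) (hint : ∀ i, μ.rowLen (i + 1) ≤ ν.rowLen i)
    (S : SymplecticTableau N ν) :
    tableauWeight w (extendTableau hμ hle hint S)
      = ((w N ^ (∑ i ∈ range ((N + 2) / 2), μ.rowLen i)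
          * (w N)⁻¹ ^ (∑ i ∈ range ((N + 1) / 2), ν.rowLen i) : Rˣ) : R) * tableauWeight w S := by
  have hsub : ν.cells ⊆ μ.cells := by
    rintro ⟨i, j⟩ hc
    rw [YoungDiagram.mem_cells, YoungDiagram.mem_iff_lt_rowLen] at hc ⊢
    exact hc.trans_le (hle i)
  rw [tableauWeight, tableauWeight, ← Units.val_mul, ← card_cells_eq_sum_rowLen hμ,
    ← card_cells_eq_sum_rowLen hν, ← prod_sdiff hsub]
  congr 2
  · rw [prod_congr rfl (g := fun _ => w N) fun c hc => ?_, prod_const, card_sdiff_of_subset hsub,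
      pow_sub _ (card_le_card hsub), inv_pow]
    obtain ⟨h₁, h₂⟩ := mem_sdiff.1 hc
    rw [YoungDiagram.mem_cells, YoungDiagram.mem_iff_lt_rowLen] at h₁ h₂
    rw [extendTableau_apply, if_neg h₂, if_pos h₁]
  · refine prod_congr rfl fun c hc => ?_
    rw [YoungDiagram.mem_cells, YoungDiagram.mem_iff_lt_rowLen] at hc
    rw [extendTableau_apply, if_pos hc]

/-- The branching rule for symplectic tableaux. -/
theorem sum_tableauWeight_eq_branchSum (w : ℕ → Rˣ) (N : ℕ) {μ : YoungDiagram}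
    (hμ : μ.colLen 0 ≤ (N + 1) / 2) :
    ∑ T : SymplecticTableau N μ, tableauWeight w T = branchSum w N μ.rowLen := by
  classical
  induction N generalizing μ with
  | zero =>
    have hempty : ∀ i j, (i, j) ∉ μ := fun i j hc => by
      rw [YoungDiagram.mem_iff_lt_rowLen, rowLen_eq_zero_of_colLen_le (hμ.trans (Nat.zero_le i))] at hc
      exact Nat.not_lt_zero j hc
    have hcells : μ.cells = ∅ := Finset.eq_empty_of_forall_notMem fun c hc => hempty c.1 c.2 hc
    have huniq : Unique (SymplecticTableau 0 μ) :=
      { default := ⟨SemistandardYoungTableau.highestWeight μ, fun i j hc => absurd hc (hempty i j)⟩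
        uniq := fun T => SymplecticTableau.ext' fun i j hc => absurd hc (hempty i j) }
    have hone : ∀ T : SymplecticTableau 0 μ, tableauWeight w T = 1 := fun T => by
      rw [tableauWeight, hcells, prod_empty, Units.val_one]
    simp only [hone, sum_const, card_univ, Fintype.card_unique, one_smul, branchSum]
  | succ N ih =>
    -- Tableaux are grouped by the shape of their first `N` letters; on each fibre, filling the
    -- complement with the letter `N` is a bijection.
    have hfib := sum_fiberwise_of_maps_to (s := (univ : Finset (SymplecticTableau (N + 1) μ)))
      (t := tupleBox ((N + 1) / 2) (fun i => μ.rowLen (i + 1)) μ.rowLen)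
      (g := fun T : SymplecticTableau (N + 1) μ => (smallDiagram N T.1).rowLen)
      (fun T _ => rowLen_smallDiagram_mem_tupleBox T) (tableauWeight (R := R) w)
    rw [branchSum, ← hfib]
    refine sum_congr rfl fun p hp => ?_
    obtain ⟨hp₁, hp₂⟩ := mem_tupleBox.1 hp
    have hanti : Antitone p := antitone_of_mem_tupleBox (p := μ.rowLen) hp
    obtain ⟨ν, rfl⟩ : ∃ ν : YoungDiagram, ν.rowLen = p :=
      ⟨diagramOfRows ((N + 1) / 2) p hanti, rowLen_diagramOfRows hanti hp₂⟩
    have hν : ν.colLen 0 ≤ (N + 1) / 2 := colLen_zero_le_iff.2 hp₂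
    have hle : ∀ i, ν.rowLen i ≤ μ.rowLen i := fun i => by
      by_cases hi : i < (N + 1) / 2
      · exact (hp₁ i hi).2
      · simp [hp₂ i (not_lt.1 hi)]
    have hint : ∀ i, μ.rowLen (i + 1) ≤ ν.rowLen i := fun i => by
      by_cases hi : i < (N + 1) / 2
      · exact (hp₁ i hi).1
      · rw [rowLen_eq_zero_of_colLen_le (by omega : μ.colLen 0 ≤ i + 1)]
        exact Nat.zero_le _
    rw [← ih hν, mul_sum]
    symm
    refine sum_bij (fun S _ => extendTableau hμ hle hint S) (fun S _ => ?_)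
      (fun S _ S' _ h => ?_) (fun T hT => ?_)
      (fun S _ => (tableauWeight_extendTableau w hμ hν hle hint S).symm)
    · simp [smallDiagram_extendTableau]
    · refine SymplecticTableau.ext' fun i j hc => ?_
      have := congrArg (fun T => T.1 i j) h
      simpa [extendTableau_apply, YoungDiagram.mem_iff_lt_rowLen.1 hc] using this
    · obtain ⟨S, hS⟩ := exists_extendTableau_eq hμ hle hint T
        (youngDiagram_eq_of_rowLen_eq (mem_filter.1 hT).2)
      exact ⟨S, mem_univ S, hS⟩

/-! ### Row lengths of rectangles and unions; sums over partitions in a box. -/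

theorem rowLen_rectangle (l r : ℕ) : (rectangle l r).rowLen = constPrefix l r fun _ => 0 := by
  funext i
  refine eq_of_forall_lt_iff fun j => ?_
  rw [← YoungDiagram.mem_iff_lt_rowLen, ← YoungDiagram.mem_cells, rectangle, constPrefix,
    mem_product, mem_range, mem_range]
  split_ifs with h <;> simp [h]

theorem colLen_rectangle_le (l r : ℕ) : (rectangle l r).colLen 0 ≤ l :=
  colLen_zero_le_iff.2 fun i hi => by rw [rowLen_rectangle, constPrefix, if_neg (not_lt.2 hi)]

theorem rowLens_rectangle (l : ℕ) {r : ℕ} (hr : 0 < r) :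
    (rectangle l r).rowLens = List.replicate l r := by
  have h : (rectangle l r).colLen 0 = l := by
    refine le_antisymm (colLen_rectangle_le l r) (le_of_forall_lt fun i hi => ?_)
    rw [← YoungDiagram.mem_iff_lt_colLen, YoungDiagram.mem_iff_lt_rowLen, rowLen_rectangle,
      constPrefix_of_lt hi]
    exact hr
  refine List.eq_replicate_iff.2 ⟨by rw [YoungDiagram.length_rowLens, h], fun b hb => ?_⟩
  rw [YoungDiagram.rowLens, List.mem_map] at hb
  obtain ⟨i, hi, rfl⟩ := hb
  rw [List.mem_range, h] at hi
  rw [rowLen_rectangle, constPrefix_of_lt hi]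

theorem rowLen_eq_zero_of_rowLen_zero {μ : YoungDiagram} (h : μ.rowLen 0 = 0) (i : ℕ) :
    μ.rowLen i = 0 :=
  Nat.le_zero.1 (h ▸ μ.rowLen_anti 0 i (Nat.zero_le i))

theorem rowLens_eq_nil {μ : YoungDiagram} (h : μ.rowLen 0 = 0) : μ.rowLens = [] := by
  rw [← List.length_eq_zero_iff, YoungDiagram.length_rowLens, ← Nat.le_zero]
  exact colLen_zero_le_iff.2 fun i _ => rowLen_eq_zero_of_rowLen_zero h i

theorem getD_rowLens (μ : YoungDiagram) (i : ℕ) : μ.rowLens.getD i 0 = μ.rowLen i := by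
  by_cases h : i < μ.rowLens.length
  · rw [List.getD_eq_getElem _ _ h]
    simp [YoungDiagram.rowLens]
  · rw [List.getD_eq_default _ _ (not_lt.1 h), rowLen_eq_zero_of_colLen_le]
    rwa [not_lt, YoungDiagram.length_rowLens] at h

theorem rowLen_ofRowLens_eq_getD (w : List ℕ) (hw : w.SortedGE) (i : ℕ) :
    (YoungDiagram.ofRowLens w hw).rowLen i = w.getD i 0 := by
  by_cases h : i < w.length
  · rw [List.getD_eq_getElem _ _ h]
    exact YoungDiagram.rowLen_ofRowLens ⟨i, h⟩
  · rw [List.getD_eq_default _ _ (not_lt.1 h)]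
    by_contra hne
    have hc := YoungDiagram.mem_iff_lt_rowLen.2 (Nat.pos_of_ne_zero hne)
    exact h (YoungDiagram.mem_ofRowLens.1 hc).1

theorem rowLen_partitionUnion_rectangle {μ : YoungDiagram} {r : ℕ} (hμ : μ.rowLen 0 ≤ r) (l : ℕ) :
    (partitionUnion (rectangle l r) μ).rowLen = constPrefix l r μ.rowLen := by
  funext i
  rw [partitionUnion, rowLen_ofRowLens_eq_getD]
  -- For `r = 0` the rectangle is empty and has no list of `l` parts; for `r > 0` the concatenated
  -- parts are already sorted, as `μ` has parts at most `r`.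
  rcases Nat.eq_zero_or_pos r with rfl | hr
  · have h₀ : μ.rowLen 0 = 0 := Nat.le_zero.1 hμ
    have h₁ : (rectangle l 0).rowLen 0 = 0 := by
      rw [rowLen_rectangle, constPrefix]
      split_ifs <;> rfl
    rw [rowLens_eq_nil h₀, rowLens_eq_nil h₁, constPrefix, rowLen_eq_zero_of_rowLen_zero h₀]
    simp
  · have hsorted : (List.replicate l r ++ μ.rowLens).Pairwise (· ≥ ·) := by
      rw [List.pairwise_append]
      refine ⟨List.pairwise_replicate.2 (Or.inr le_rfl), μ.rowLens_sorted.pairwise, ?_⟩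
      intro a ha b hb
      rw [List.eq_of_mem_replicate ha]
      rw [YoungDiagram.rowLens, List.mem_map] at hb
      obtain ⟨j, -, rfl⟩ := hb
      exact (μ.rowLen_anti 0 j (Nat.zero_le j)).trans hμ
    rw [rowLens_rectangle l hr, Multiset.coe_add, Multiset.coe_sort,
      List.mergeSort_eq_self _ hsorted, constPrefix]
    split_ifs with h
    · rw [List.getD_append _ _ _ _ (by simpa using h)]
      simp [h]
    · rw [List.getD_append_right _ _ _ _ (by simpa using h), List.length_replicate, getD_rowLens]

/-- At an ascent of `c` no `ν i` satisfies `c (i + 1) ≤ ν i ≤ c i`. Hence a sum over partitions may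
be extended to all tuples in the box. -/
theorem branchSum_odd_eq_zero (w : ℕ → Rˣ) (m : ℕ) {c : ℕ → ℕ} (hc : ∀ i, m + 1 ≤ i → c i = 0)
    (h : ¬ Antitone c) : branchSum w (2 * m + 1) c = 0 := by
  have h' : ∃ i, c i < c (i + 1) := by
    by_contra! h'
    exact h (antitone_nat_of_succ_le h')
  obtain ⟨i, hi⟩ := h'
  have him : i < m := by
    by_contra him
    rw [hc (i + 1) (by omega)] at hi
    exact Nat.not_lt_zero _ hi
  rw [branchSum, show (2 * m + 1) / 2 = m by omega, sum_eq_zero]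
  intro ν hν
  have := (mem_tupleBox.1 hν).1 i him
  omega

theorem sum_partitionInBox (l r : ℕ) (F : (ℕ → ℕ) → R)
    (hF : ∀ c ∈ tupleBox l (fun _ => 0) (fun _ => r), ¬ Antitone c → F c = 0) :
    ∑ μ : PartitionInBox l r, F μ.1.rowLen = ∑ c ∈ tupleBox l (fun _ => 0) fun _ => r, F c := by
  refine sum_of_injOn (fun μ : PartitionInBox l r => μ.1.rowLen) ?_ ?_ ?_ fun _ _ => rfl
  · intro μ _ ν _ h
    exact Subtype.ext (youngDiagram_eq_of_rowLen_eq h)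
  · intro μ _
    exact mem_tupleBox.2 ⟨fun i _ => ⟨Nat.zero_le _,
      (μ.1.rowLen_anti 0 i (Nat.zero_le i)).trans μ.2.2⟩, colLen_zero_le_iff.1 μ.2.1⟩
  · intro c hc hne
    refine hF c hc fun hanti => hne ?_
    obtain ⟨h₁, h₂⟩ := mem_tupleBox.1 hc
    have hrow := rowLen_diagramOfRows hanti h₂
    refine ⟨⟨diagramOfRows l c hanti, colLen_zero_le_iff.2 (by rwa [hrow]), ?_⟩, mem_univ _, hrow⟩
    rw [hrow]
    by_cases hl : 0 < l
    · exact (h₁ 0 hl).2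
    · simp [h₂ 0 (not_lt.1 hl)]

/-! ### Characters as chain sums and the order of the variables. -/

theorem oddSymplecticChar_eq_branchSum {n : ℕ} {μ : YoungDiagram} (hμ : μ.colLen 0 ≤ n + 1)
    (x : Fin n → Rˣ) (z : Rˣ) :
    oddSymplecticChar μ x z = branchSum (letterWeight x z) (2 * n + 1) μ.rowLen :=
  sum_tableauWeight_eq_branchSum _ _ (by omega)

theorem symplecticChar_eq_branchSum {n : ℕ} {μ : YoungDiagram} (hμ : μ.colLen 0 ≤ n)
    (x : Fin n → Rˣ) :
    symplecticChar μ x = branchSum (letterWeight x 1) (2 * n) μ.rowLen :=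
  sum_tableauWeight_eq_branchSum _ _ (by omega)

theorem letterWeight_even {n : ℕ} (x : Fin n → Rˣ) (z : Rˣ) {k : ℕ} (hk : k < n) :
    letterWeight x z (2 * k) = x ⟨k, hk⟩ := by
  simp [letterWeight, hk]

theorem letterWeight_odd {n : ℕ} (x : Fin n → Rˣ) (z : Rˣ) {k : ℕ} (hk : k < n) :
    letterWeight x z (2 * k + 1) = (x ⟨k, hk⟩)⁻¹ := by
  have h : (2 * k + 1) / 2 = k := by omega
  simp [letterWeight, h, hk, Nat.add_mod]

theorem letterWeight_last {n : ℕ} (x : Fin n → Rˣ) (z : Rˣ) : letterWeight x z (2 * n) = z := by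
  simp [letterWeight]

theorem prod_letterWeight {n : ℕ} (x : Fin n → Rˣ) (z : Rˣ) :
    ∏ a ∈ range (2 * n + 1), letterWeight x z a = z := by
  have h : ∀ k ≤ n, ∏ a ∈ range (2 * k), letterWeight x z a = 1 := by
    intro k
    induction k with
    | zero => simp
    | succ k ih =>
      intro hk
      rw [mul_add, mul_one, prod_range_succ, prod_range_succ, ih (by omega), letterWeight_even x z hk,
        letterWeight_odd x z hk, one_mul, mul_inv_cancel]
  rw [prod_range_succ, h n le_rfl, one_mul, letterWeight_last]

/-- The variables `y 0, …, y (n - 1), z, x (m - 1), …, x 0`. -/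
def rearrangedVariables {m n : ℕ} (x : Fin m → Rˣ) (y : Fin n → Rˣ) (z : Rˣ) (a : ℕ) : Rˣ :=
  if h : a < n then y ⟨a, h⟩ else if h : n < a ∧ a ≤ m + n then x ⟨m + n - a, by omega⟩ else z

section rearrangedVariables

variable {m n : ℕ} (x : Fin m → Rˣ) (y : Fin n → Rˣ) (z : Rˣ)

theorem rearrangedVariables_of_lt {a : ℕ} (h : a < n) :
    rearrangedVariables x y z a = y ⟨a, h⟩ := by
  simp [rearrangedVariables, h]

theorem rearrangedVariables_self : rearrangedVariables x y z n = z := by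
  simp [rearrangedVariables]

theorem rearrangedVariables_sub {a : ℕ} (h : a < m) :
    rearrangedVariables x y z (m + n - a) = x ⟨a, h⟩ := by
  have h₁ : ¬ m + n - a < n := by omega
  have h₂ : n < m + n - a := by omega
  have h₃ : m + n - (m + n - a) = a := by omega
  simp [rearrangedVariables, h₁, h₂, h₃]

theorem pairWeight_rearrangedVariables {a : ℕ} (ha : a < 2 * n + 1) :
    pairWeight (rearrangedVariables x y z) a = letterWeight y z a := by
  obtain ⟨k, rfl | rfl⟩ := Nat.even_or_odd' a
  · rw [pairWeight_even]
    rcases Nat.lt_or_ge k n with hk | hk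
    · rw [letterWeight_even y z hk, rearrangedVariables_of_lt x y z hk]
    · obtain rfl : k = n := by omega
      rw [letterWeight_last, rearrangedVariables_self]
  · have hk : k < n := by omega
    rw [pairWeight_odd, letterWeight_odd y z hk, rearrangedVariables_of_lt x y z hk]

/-- Read from the top, the letters have weights `x₁⁻¹, x₁, …, x_m⁻¹, x_m, z⁻¹`; inverted, they are
exactly the weights for the odd character in `x` and `z`. -/
theorem pairWeight_rearrangedVariables_reverse {a : ℕ} (ha : a < 2 * m + 1) :
    (pairWeight (rearrangedVariables x y z) (2 * (m + n + 1) - 1 - a))⁻¹ = letterWeight x z a := by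
  obtain ⟨k, rfl | rfl⟩ := Nat.even_or_odd' a
  · rw [show 2 * (m + n + 1) - 1 - 2 * k = 2 * (m + n - k) + 1 by omega, pairWeight_odd, inv_inv]
    rcases Nat.lt_or_ge k m with hk | hk
    · rw [letterWeight_even x z hk, rearrangedVariables_sub x y z hk]
    · obtain rfl : k = m := by omega
      rw [letterWeight_last, Nat.add_sub_cancel_left, rearrangedVariables_self]
  · have hk : k < m := by omega
    rw [show 2 * (m + n + 1) - 1 - (2 * k + 1) = 2 * (m + n - k) by omega, pairWeight_even,
      letterWeight_odd x z hk, rearrangedVariables_sub x y z hk]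

theorem prod_rearrangedVariables {M : Type*} [CommMonoid M] (q : Rˣ → M) :
    ∏ a ∈ range (m + n + 1), q (rearrangedVariables x y z a)
      = ∏ i : Fin (m + n + 1), q ((Fin.snoc (α := fun _ => Rˣ) (Fin.append x y) z :
          Fin (m + n + 1) → Rˣ) i) := by
  rw [Fin.prod_univ_castSucc, Fin.snoc_last]
  simp only [Fin.snoc_castSucc]
  rw [Fin.prod_univ_add]
  simp only [Fin.append_left, Fin.append_right]
  have h₁ : ∏ a ∈ range n, q (rearrangedVariables x y z a) = ∏ i, q (y i) := by
    rw [prod_range]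
    exact prod_congr rfl fun i _ => by rw [rearrangedVariables_of_lt x y z i.2]
  have h₂ : ∏ a ∈ range m, q (rearrangedVariables x y z (n + 1 + a)) = ∏ i, q (x i) := by
    rw [← prod_range_reflect, prod_range]
    refine prod_congr rfl fun i _ => ?_
    rw [show n + 1 + (m - 1 - i) = m + n - i by omega, rearrangedVariables_sub x y z i.2]
  rw [show m + n + 1 = (n + 1) + m by ring, prod_range_add, prod_range_succ,
    rearrangedVariables_self, h₁, h₂, mul_comm, mul_assoc]

end rearrangedVariables

theorem symplecticChar_snoc_append {m n : ℕ} {μ : YoungDiagram} (hμ : μ.colLen 0 ≤ m + n + 1)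
    (x : Fin m → Rˣ) (y : Fin n → Rˣ) (z : Rˣ) :
    symplecticChar μ
        (Fin.snoc (α := fun _ => Rˣ) (Fin.append x y) z : Fin (m + n + 1) → Rˣ)
      = branchSum (pairWeight (rearrangedVariables x y z)) (2 * (m + n + 1)) μ.rowLen := by
  rw [symplecticChar_eq_branchSum hμ]
  set U : Fin (m + n + 1) → Rˣ := Fin.snoc (α := fun _ => Rˣ) (Fin.append x y) z with hU
  let u : ℕ → Rˣ := fun a => if h : a < m + n + 1 then U ⟨a, h⟩ else 1
  have hu : ∀ i : Fin (m + n + 1), u i = U i := fun i => dif_pos i.2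
  rw [branchSum_congr (w' := pairWeight u),
    branchSum_two_mul_symm (u := u) (v := rearrangedVariables x y z) _
      (fun i j hij => μ.rowLen_anti i j hij) (rowLen_eq_zero_of_colLen_le hμ)]
  · rw [prod_rearrangedVariables x y z pairSeries, prod_range]
    exact prod_congr rfl fun i _ => by rw [hu]
  · intro a ha
    have : a / 2 < m + n + 1 := by omega
    simp only [letterWeight, pairWeight, u, dif_pos this]

end Lemmas

theorem mainTheorem1 {R : Type*} [CommRing R] (m n r : ℕ) (hmn : m ≤ n)
    (x : Fin m → Rˣ) (y : Fin n → Rˣ) (z : Rˣ) :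
    ∑ μ : PartitionInBox (m + 1) r,
        ((z⁻¹ ^ r : Rˣ) : R) * oddSymplecticChar μ.1 x z
          * oddSymplecticChar (partitionUnion (rectangle (n - m) r) μ.1) y z
      = symplecticChar (rectangle (m + n + 1) r)
          (Fin.snoc (α := fun _ => Rˣ) (Fin.append x y) z : Fin (m + n + 1) → Rˣ) := by
  have hterm : ∀ μ : PartitionInBox (m + 1) r,
      ((z⁻¹ ^ r : Rˣ) : R) * oddSymplecticChar μ.1 x z
          * oddSymplecticChar (partitionUnion (rectangle (n - m) r) μ.1) y z
        = ((z⁻¹ ^ r : Rˣ) : R) * (branchSum (letterWeight x z) (2 * m + 1) μ.1.rowLen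
          * branchSum (letterWeight y z) (2 * n + 1) (constPrefix (n - m) r μ.1.rowLen)) := by
    intro μ
    have hrow := rowLen_partitionUnion_rectangle μ.2.2 (n - m)
    rw [oddSymplecticChar_eq_branchSum μ.2.1, oddSymplecticChar_eq_branchSum, hrow, mul_assoc]
    refine colLen_zero_le_iff.2 fun i hi => ?_
    rw [hrow, constPrefix, if_neg (by omega)]
    exact rowLen_eq_zero_of_colLen_le (μ.2.1.trans (by omega))
  -- The rectangle is cut at `j = 2 * m + 1`, which is at most `m + n + 1` because `m ≤ n`.
  rw [sum_congr rfl fun μ _ => hterm μ, ← mul_sum,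
    sum_partitionInBox (m + 1) r (fun c => branchSum (letterWeight x z) (2 * m + 1) c
      * branchSum (letterWeight y z) (2 * n + 1) (constPrefix (n - m) r c)) fun c hc h => by
        rw [branchSum_odd_eq_zero _ m (mem_tupleBox.1 hc).2 h, zero_mul],
    symplecticChar_snoc_append (colLen_rectangle_le _ r), rowLen_rectangle,
    branchSum_rectangle _ _ r (2 * m + 1) (by omega), show (2 * m + 1 + 1) / 2 = m + 1 by omega,
    show 2 * (m + n + 1) - (2 * m + 1) = 2 * n + 1 by omega,
    show m + n + 1 - (2 * m + 1) = n - m by omega]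
  congr 1
  -- Among the removed letters the weights of each `x`-pair cancel, so their product is `z⁻¹`; this
  -- is the source of `z ^ (-r)`.
  · rw [prod_pow, inv_pow, ← prod_letterWeight x z, ← inv_pow, ← prod_inv_distrib]
    refine congrArg (fun w : Rˣ => ((w ^ r : Rˣ) : R)) (prod_congr rfl fun a ha => ?_)
    rw [prod_letterWeight, ← pairWeight_rearrangedVariables_reverse x y z (mem_range.1 ha), inv_inv]
  · refine sum_congr rfl fun c _ => ?_
    congr 1
    · exact branchSum_congr (fun a ha => (pairWeight_rearrangedVariables_reverse x y z ha).symm) c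
    · exact branchSum_congr (fun a ha => (pairWeight_rearrangedVariables x y z ha).symm) _
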